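/- A Čech closure space $(X,c)$ is a set $X$ with a map $c:\mathcal P(X)\to\mathcal P(X)$ such that $c(\emptyset)=\emptyset$, $A\subseteq c(A)$ and $c(A\cup B)=c(A)\cup c(B)$. A map $f:(X,c)\to(Y,c')$ is continuous if $f(c(U))\subseteq c'(f(U))$ for every $U\subseteq X$. A set $U$ is a neighborhood of $x$ if $x\in X\setminus c(X\setminus U)$, and the product closure on $X\times Y$ is the one for which the sets $U\times V$, with $U$ a neighborhood of $x$ and $V$ a neighborhood of $y$, form a base of the neighborhoods of $(x,y)$. For a base point $x\in X$, the group $\pi_1((X,c),x)$ consists of the continuous maps $\gamma:[0,1]\to(X,c)$ with $\gamma(0)=\gamma(1)=x$, up to homotopy relative to $\{0,1\}$ (that is, through continuous maps $H:[0,1]\times[0,1]\to(X,c)$ on the product closure space), with the product given by concatenation; here $[0,1]$ carries its topological closure operator. A continuous map $f$ induces the homomorphism $f_*[\gamma]=[f\circ\gamma]$. **Theorem.** Let $m,n\in\mathbb N$ satisfy $3\le 3m<n$. Let $S^1=\mathbb R/\mathbb Z$ with its topological closure operator $\tau$, and let $\mathbb Z_n=\mathbb Z/n\mathbb Z$ with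 the closure operator $$c_{m,n}(A)=\bigcup_{k\in A}\{k-m,\dots,k-1,k,k+1,\dots,k+m\}\bmod n .$$ Define $f:(S^1,\tau)\to(\mathbb Z_n,c_{m,n})$ by $$f(t)=i \quad\text{for } t\in\Big[\frac{2i-1}{2n},\frac{2i+1}{2n}\Big),$$ where the interval is understood mod $1$. Then $f$ is continuous, and for every base point $x\in S^1$ the induced homomorphism $f_*:\pi_1((S^1,\tau),x)\to\pi_1((\mathbb Z_n,c_{m,n}),f(x))$ is an isomorphism of groups. -/

import Mathlib

/-- A Čech closure operator on `X`: a closure structure, not necessarily idempotent. -/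
@[ext]
structure CechClosure (X : Type*) where
  cl : Set X → Set X
  cl_empty : cl ∅ = ∅
  subset_cl : ∀ A, A ⊆ cl A
  cl_union : ∀ A B, cl (A ∪ B) = cl A ∪ cl B

namespace CechClosure

open scoped unitInterval

variable {X Y Z T : Type*}

theorem cl_mono (c : CechClosure X) {A B : Set X} (h : A ⊆ B) : c.cl A ⊆ c.cl B := by
  have := c.cl_union A B
  rw [Set.union_eq_self_of_subset_left h] at this
  rw [this]
  exact Set.subset_union_left

/-- `U` is a neighborhood of the point `x` when `x ∈ X - c (X - U)`. -/
def IsNhd (c : CechClosure X) (U : Set X) (x : X) : Prop := x ∈ (c.cl Uᶜ)ᶜ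

theorem IsNhd.inter {c : CechClosure X} {U V : Set X} {x : X}
    (hU : c.IsNhd U x) (hV : c.IsNhd V x) : c.IsNhd (U ∩ V) x := by
  unfold IsNhd at *
  rw [Set.compl_inter, c.cl_union]
  simp only [Set.mem_compl_iff, Set.mem_union, not_or] at *
  exact ⟨hU, hV⟩

theorem IsNhd.mem {c : CechClosure X} {U : Set X} {x : X} (hU : c.IsNhd U x) : x ∈ U := by
  by_contra h
  exact hU (c.subset_cl _ h)

/-- Continuity of a map of closure spaces: `x ∈ c(U)` implies `f x ∈ c'(f(U))`. -/
def IsCont (c : CechClosure X) (c' : CechClosure Y) (f : X → Y) : Prop :=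
  ∀ (x : X) (U : Set X), x ∈ c.cl U → f x ∈ c'.cl (f '' U)

theorem IsCont.comp {c : CechClosure X} {c' : CechClosure Y} {c'' : CechClosure Z}
    {g : Y → Z} {f : X → Y} (hg : IsCont c' c'' g) (hf : IsCont c c' f) :
    IsCont c c'' (g ∘ f) := by
  intro x U hx
  rw [Set.image_comp]
  exact hg _ _ (hf _ _ hx)

/-- The closure structure of a topological space. -/
def ofTop (X : Type*) [TopologicalSpace X] : CechClosure X where
  cl := closure
  cl_empty := closure_empty
  subset_cl _ := subset_closure
  cl_union _ _ := closure_union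

/-- The product closure structure: the sets `U × V`, with `U` and `V` neighborhoods of the
coordinates of a point, form a local base at that point. -/
def prod (c : CechClosure X) (c' : CechClosure Y) : CechClosure (X × Y) where
  cl A := {p | ∀ U V, c.IsNhd U p.1 → c'.IsNhd V p.2 → ((U ×ˢ V) ∩ A).Nonempty}
  cl_empty := by
    ext p
    simp only [Set.mem_ofPred_eq, Set.inter_empty, Set.not_nonempty_empty, Set.mem_empty_iff_false,
      iff_false, not_forall]
    exact ⟨Set.univ, Set.univ, by simp [IsNhd, cl_empty], by simp [IsNhd, cl_empty], by simp⟩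
  subset_cl A p hp U V hU hV := ⟨p, ⟨hU.mem, hV.mem⟩, hp⟩
  cl_union A B := by
    ext p
    constructor
    · intro h
      by_contra hn
      simp only [Set.mem_union, Set.mem_ofPred_eq, not_or, not_forall] at hn
      obtain ⟨⟨U, V, hU, hV, h1⟩, ⟨U', V', hU', hV', h2⟩⟩ := hn
      obtain ⟨q, ⟨⟨hq1, hq1'⟩, hq2, hq2'⟩, hq | hq⟩ := h _ _ (hU.inter hU') (hV.inter hV')
      · exact h1 ⟨q, ⟨hq1, hq2⟩, hq⟩
      · exact h2 ⟨q, ⟨hq1', hq2'⟩, hq⟩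
    · rintro (h | h) U V hU hV
      · exact (h U V hU hV).mono (Set.inter_subset_inter_right _ Set.subset_union_left)
      · exact (h U V hU hV).mono (Set.inter_subset_inter_right _ Set.subset_union_right)

theorem isNhd_ofTop [TopologicalSpace X] {U : Set X} {x : X} :
    (ofTop X).IsNhd U x ↔ U ∈ nhds x := by
  rw [IsNhd, ofTop, ← interior_eq_compl_closure_compl, mem_interior_iff_mem_nhds]

theorem prod_ofTop [TopologicalSpace X] [TopologicalSpace Y] :
    prod (ofTop X) (ofTop Y) = ofTop (X × Y) := by
  ext A p
  change (∀ U V, _ → _ → _) ↔ p ∈ closure A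
  rw [mem_closure_iff_nhds]
  simp only [isNhd_ofTop]
  constructor
  · intro h t ht
    rw [nhds_prod_eq, Filter.mem_prod_iff] at ht
    obtain ⟨U, hU, V, hV, hs⟩ := ht
    exact (h U V hU hV).mono (Set.inter_subset_inter_left _ hs)
  · intro h U V hU hV
    exact h _ (prod_mem_nhds hU hV)

theorem isCont_ofTop [TopologicalSpace X] [TopologicalSpace Y] {f : X → Y} (hf : Continuous f) :
    IsCont (ofTop X) (ofTop Y) f := by
  intro x U hx
  exact image_closure_subset_closure_image hf ⟨x, hx, rfl⟩

/-- Gluing of two continuous maps along the closed sets `r ≤ 1/2` and `1/2 ≤ r`. -/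
theorem isCont_glue [TopologicalSpace T] {c : CechClosure X} {r : T → ℝ} (hr : Continuous r)
    {f g : T → X} (hf : IsCont (ofTop T) c f) (hg : IsCont (ofTop T) c g)
    (h : ∀ t, r t = 1 / 2 → f t = g t) :
    IsCont (ofTop T) c (fun t => if r t ≤ 1 / 2 then f t else g t) := by
  intro x U hx
  have hU : U = (U ∩ {t | r t ≤ 1 / 2}) ∪ (U ∩ {t | 1 / 2 ≤ r t}) := by
    rw [← Set.inter_union_distrib_left]
    refine (Set.inter_eq_left.2 fun t _ => ?_).symm
    exact le_total (r t) (1 / 2)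
  rw [hU, cl_union] at hx
  rcases hx with hx | hx
  · have h1 : r x ≤ 1 / 2 := by
      have : x ∈ closure {t | r t ≤ 1 / 2} := closure_mono Set.inter_subset_right hx
      rwa [(isClosed_le hr continuous_const).closure_eq] at this
    simp only [if_pos h1]
    refine c.cl_mono ?_ (hf _ _ hx)
    rintro _ ⟨t, ⟨ht, ht'⟩, rfl⟩
    exact ⟨t, ht, if_pos ht'⟩
  · have h1 : 1 / 2 ≤ r x := by
      have : x ∈ closure {t | 1 / 2 ≤ r t} := closure_mono Set.inter_subset_right hx
      rwa [(isClosed_le continuous_const hr).closure_eq] at this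
    have key : ∀ t, 1 / 2 ≤ r t → (if r t ≤ 1 / 2 then f t else g t) = g t := by
      intro t ht
      split_ifs with h2
      · exact h t (le_antisymm h2 ht)
      · rfl
    simp only [key x h1]
    refine c.cl_mono ?_ (hg _ _ hx)
    rintro _ ⟨t, ⟨ht, ht'⟩, rfl⟩
    exact ⟨t, ht, key t ht'⟩

/-- A loop at `x`: a continuous map from the topological interval `[0,1]` that sends both end
points to `x`. -/
@[ext]
structure Loop (c : CechClosure X) (x : X) where
  toFun : I → X
  cont : IsCont (ofTop I) c toFun
  zero : toFun 0 = x
  one : toFun 1 = x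

/-- Loops are homotopic relative to the end points, where the square `[0,1] × [0,1]` carries the
product closure structure. -/
def Loop.Homotopic {c : CechClosure X} {x : X} (f g : Loop c x) : Prop :=
  ∃ H : I × I → X, IsCont (prod (ofTop I) (ofTop I)) c H ∧
    (∀ s, H (s, 0) = f.toFun s) ∧ (∀ s, H (s, 1) = g.toFun s) ∧
    (∀ t, H (0, t) = x) ∧ (∀ t, H (1, t) = x)

/-- The point of `[0,1]` nearest to a real number; on `[0,1]` it is the identity. -/
noncomputable def clamp (a : ℝ) : I := Set.projIcc 0 1 zero_le_one a

theorem continuous_clamp : Continuous clamp :=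
  continuous_projIcc (h := zero_le_one (α := ℝ))

theorem clamp_of_le {a : ℝ} (h : a ≤ 0) : clamp a = 0 := Set.projIcc_of_le_left _ h

theorem clamp_of_ge {a : ℝ} (h : 1 ≤ a) : clamp a = 1 := Set.projIcc_of_right_le _ h

theorem clamp_val (a : I) : clamp (a : ℝ) = a := Set.projIcc_val _ a

theorem val_clamp {a : ℝ} (h0 : 0 ≤ a) (h1 : a ≤ 1) : (clamp a : ℝ) = a := by
  rw [clamp, Set.projIcc_of_mem _ ⟨h0, h1⟩]

namespace Loop

variable {c : CechClosure X} {c' : CechClosure Y} {x : X}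

theorem zero_clamp (f : Loop c x) {a : ℝ} (h : a ≤ 0) : f.toFun (clamp a) = x := by
  rw [clamp_of_le h, f.zero]

theorem one_clamp (f : Loop c x) {a : ℝ} (h : 1 ≤ a) : f.toFun (clamp a) = x := by
  rw [clamp_of_ge h, f.one]

/-- The concatenation `f ⋆ g`: it is `f (2t)` for `t ≤ 1/2` and `g (2t - 1)` for `t > 1/2`. -/
noncomputable def star (f g : Loop c x) : Loop c x where
  toFun t := if (t : ℝ) ≤ 1 / 2 then f.toFun (clamp (2 * t)) else g.toFun (clamp (2 * t - 1))
  cont := by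
    refine isCont_glue (r := fun t : I => (t : ℝ)) continuous_subtype_val
      (f.cont.comp (isCont_ofTop (f := fun t : I => clamp (2 * t))
        (continuous_clamp.comp (by fun_prop))))
      (g.cont.comp (isCont_ofTop (f := fun t : I => clamp (2 * t - 1))
        (continuous_clamp.comp (by fun_prop)))) ?_
    intro t ht
    rw [f.one_clamp (by linarith), g.zero_clamp (by linarith)]
  zero := by
    rw [if_pos (by norm_num)]
    exact f.zero_clamp (by simp)
  one := by
    rw [if_neg (by norm_num)]
    exact g.one_clamp (by norm_num)

/-- The constant loop. -/
def const (c : CechClosure X) (x : X) : Loop c x where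
  toFun _ := x
  cont t U ht := by
    have hU : U.Nonempty := closure_nonempty_iff.1 ⟨t, ht⟩
    apply c.subset_cl
    obtain ⟨u, hu⟩ := hU
    exact ⟨u, hu, rfl⟩
  zero := rfl
  one := rfl

/-- The reversed loop. -/
def reverse (f : Loop c x) : Loop c x where
  toFun t := f.toFun (unitInterval.symm t)
  cont := f.cont.comp (isCont_ofTop unitInterval.continuous_symm)
  zero := by simp [f.one]
  one := by simp [f.zero]

/-- The image of a loop under a continuous map. -/
def map (f : X → Y) (hf : IsCont c c' f) (γ : Loop c x) : Loop c' (f x) where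
  toFun := f ∘ γ.toFun
  cont := hf.comp γ.cont
  zero := congrArg f γ.zero
  one := congrArg f γ.one

theorem homotopic_reparam (f g h : Loop c x) (φ ψ : I → I) (hφ : Continuous φ) (hψ : Continuous ψ)
    (h0 : φ 0 = ψ 0) (h1 : φ 1 = ψ 1) (hg : ∀ s, g.toFun s = f.toFun (φ s))
    (hh : ∀ s, h.toFun s = f.toFun (ψ s)) : g.Homotopic h := by
  refine ⟨fun p => f.toFun (clamp ((1 - p.2) * φ p.1 + p.2 * ψ p.1)), ?_, ?_, ?_, ?_, ?_⟩
  · rw [prod_ofTop]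
    exact f.cont.comp (isCont_ofTop
      (f := fun p : I × I => clamp ((1 - p.2) * φ p.1 + p.2 * ψ p.1))
      (continuous_clamp.comp (by fun_prop)))
  · intro s
    simp [clamp_val, hg]
  · intro s
    simp [clamp_val, hh]
  · intro t
    have : ((1 - t) * φ 0 + t * ψ 0 : ℝ) = φ 0 := by rw [h0]; ring
    simp only [this, clamp_val]
    rw [← hg, g.zero]
  · intro t
    have : ((1 - t) * φ 1 + t * ψ 1 : ℝ) = φ 1 := by rw [h1]; ring
    simp only [this, clamp_val]
    rw [← hg, g.one]

theorem Homotopic.refl (f : Loop c x) : f.Homotopic f :=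
  homotopic_reparam f f f id id continuous_id continuous_id rfl rfl (fun _ => rfl) fun _ => rfl

theorem Homotopic.symm {f g : Loop c x} (h : f.Homotopic g) : g.Homotopic f := by
  obtain ⟨H, hH, h0, h1, h2, h3⟩ := h
  refine ⟨fun p => H (p.1, unitInterval.symm p.2), ?_, by simp [h1], by simp [h0],
    fun t => h2 _, fun t => h3 _⟩
  rw [prod_ofTop] at hH ⊢
  exact hH.comp (isCont_ofTop (f := fun p : I × I => (p.1, unitInterval.symm p.2)) (by fun_prop))

theorem Homotopic.trans {f g h : Loop c x} (hfg : f.Homotopic g) (hgh : g.Homotopic h) :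
    f.Homotopic h := by
  obtain ⟨H, hH, h0, h1, h2, h3⟩ := hfg
  obtain ⟨K, hK, k0, k1, k2, k3⟩ := hgh
  refine ⟨fun p => if (p.2 : ℝ) ≤ 1 / 2 then H (p.1, clamp (2 * p.2))
    else K (p.1, clamp (2 * p.2 - 1)), ?_, ?_, ?_, ?_, ?_⟩
  · rw [prod_ofTop] at hH hK ⊢
    refine isCont_glue (r := fun p : I × I => (p.2 : ℝ)) (by fun_prop)
      (hH.comp (isCont_ofTop (f := fun p : I × I => (p.1, clamp (2 * p.2)))
        (continuous_fst.prodMk (continuous_clamp.comp (by fun_prop)))))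
      (hK.comp (isCont_ofTop (f := fun p : I × I => (p.1, clamp (2 * p.2 - 1)))
        (continuous_fst.prodMk (continuous_clamp.comp (by fun_prop))))) ?_
    intro p hp
    rw [clamp_of_ge (by linarith), clamp_of_le (by linarith), h1, k0]
  · intro s
    beta_reduce
    rw [if_pos (by norm_num), clamp_of_le (by simp), h0]
  · intro s
    beta_reduce
    rw [if_neg (by norm_num), clamp_of_ge (by norm_num), k1]
  · intro t
    beta_reduce
    split_ifs
    · exact h2 _
    · exact k2 _
  · intro t
    beta_reduce
    split_ifs
    · exact h3 _
    · exact k3 _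

theorem Homotopic.star {f f' g g' : Loop c x} (hf : f.Homotopic f') (hg : g.Homotopic g') :
    (f.star g).Homotopic (f'.star g') := by
  obtain ⟨H, hH, h0, h1, h2, h3⟩ := hf
  obtain ⟨K, hK, k0, k1, k2, k3⟩ := hg
  refine ⟨fun p => if (p.1 : ℝ) ≤ 1 / 2 then H (clamp (2 * p.1), p.2)
    else K (clamp (2 * p.1 - 1), p.2), ?_, ?_, ?_, ?_, ?_⟩
  · rw [prod_ofTop] at hH hK ⊢
    refine isCont_glue (r := fun p : I × I => (p.1 : ℝ)) (by fun_prop)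
      (hH.comp (isCont_ofTop (f := fun p : I × I => (clamp (2 * p.1), p.2))
        ((continuous_clamp.comp (by fun_prop)).prodMk continuous_snd)))
      (hK.comp (isCont_ofTop (f := fun p : I × I => (clamp (2 * p.1 - 1), p.2))
        ((continuous_clamp.comp (by fun_prop)).prodMk continuous_snd))) ?_
    intro p hp
    rw [clamp_of_ge (by linarith), clamp_of_le (by linarith), h3, k2]
  · intro s
    simp only [h0, k0, Loop.star]
  · intro s
    simp only [h1, k1, Loop.star]
  · intro t
    beta_reduce
    rw [if_pos (by norm_num), clamp_of_le (by simp), h2]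
  · intro t
    beta_reduce
    rw [if_neg (by norm_num), clamp_of_ge (by norm_num), k3]

theorem const_star (f : Loop c x) : ((const c x).star f).Homotopic f := by
  refine homotopic_reparam f _ _ (fun s => clamp (2 * s - 1)) id
    (continuous_clamp.comp (by fun_prop)) continuous_id ?_ ?_ ?_ fun _ => rfl
  · exact clamp_of_le (by norm_num)
  · exact clamp_of_ge (by norm_num)
  · intro s
    simp only [star, const]
    split_ifs with h
    · rw [f.zero_clamp (by linarith)]
    · rfl

theorem reverse_star (f : Loop c x) : (f.reverse.star f).Homotopic (const c x) := by
  refine homotopic_reparam f _ _ (fun s => clamp |2 * (s : ℝ) - 1|) (fun _ => 1)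
    (continuous_clamp.comp (by fun_prop)) continuous_const ?_ ?_ ?_ fun _ => f.one.symm
  · exact clamp_of_ge (by norm_num)
  · exact clamp_of_ge (by norm_num)
  · intro s
    have hs := s.2.1
    simp only [star, reverse]
    split_ifs with h
    · congr 1
      apply Subtype.ext
      rw [abs_of_nonpos (by linarith), unitInterval.coe_symm_eq,
        val_clamp (by linarith) (by linarith), val_clamp (by linarith) (by linarith)]
      ring
    · rw [abs_of_nonneg (by linarith)]

theorem star_assoc (f g h : Loop c x) :
    ((f.star g).star h).Homotopic (f.star (g.star h)) := by
  refine homotopic_reparam (f.star (g.star h)) _ _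
    (fun s => clamp (min (2 * (s : ℝ)) (min (s + 1 / 4) ((s + 1) / 2)))) id
    (continuous_clamp.comp (by fun_prop)) continuous_id ?_ ?_ ?_ fun _ => rfl
  · exact clamp_of_le (by norm_num)
  · exact clamp_of_ge (by norm_num)
  · intro s
    have hs := s.2.1
    have hs' := s.2.2
    rcases le_or_gt (s : ℝ) (1 / 4) with h4 | h4
    · rw [min_eq_left (le_min (by linarith) (by linarith))]
      have e := val_clamp (a := 2 * (s : ℝ)) (by linarith) (by linarith)
      simp only [star, e]
      rw [if_pos (by linarith), if_pos (by linarith), if_pos (by linarith)]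
    rcases le_or_gt (s : ℝ) (1 / 2) with h2 | h2
    · rw [min_eq_right (min_le_of_left_le (by linarith)), min_eq_left (by linarith)]
      have e := val_clamp (a := 2 * (s : ℝ)) (by linarith) (by linarith)
      have e1 := val_clamp (a := (s : ℝ) + 1 / 4) (by linarith) (by linarith)
      have e2 := val_clamp (a := 2 * ((s : ℝ) + 1 / 4) - 1) (by linarith) (by linarith)
      simp only [star, e, e1, e2]
      rw [if_pos (by linarith), if_neg (by linarith), if_neg (by linarith), if_pos (by linarith)]
      congr 2
      ring
    · rw [min_eq_right (min_le_of_right_le (by linarith)), min_eq_right (by linarith)]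
      have e1 := val_clamp (a := ((s : ℝ) + 1) / 2) (by linarith) (by linarith)
      have e2 := val_clamp (a := 2 * (((s : ℝ) + 1) / 2) - 1) (by linarith) (by linarith)
      simp only [star, e1, e2]
      rw [if_neg (by linarith), if_neg (by linarith), if_neg (by linarith)]
      congr 2
      ring

theorem Homotopic.reverse {f g : Loop c x} (h : f.Homotopic g) :
    f.reverse.Homotopic g.reverse := by
  obtain ⟨H, hH, h0, h1, h2, h3⟩ := h
  refine ⟨fun p => H (unitInterval.symm p.1, p.2), ?_, fun s => h0 _, fun s => h1 _,
    by simp [h3], by simp [h2]⟩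
  rw [prod_ofTop] at hH ⊢
  exact hH.comp (isCont_ofTop (f := fun p : I × I => (unitInterval.symm p.1, p.2)) (by fun_prop))

theorem Homotopic.map {f : X → Y} (hf : IsCont c c' f) {γ δ : Loop c x} (h : γ.Homotopic δ) :
    (γ.map f hf).Homotopic (δ.map f hf) := by
  obtain ⟨H, hH, h0, h1, h2, h3⟩ := h
  exact ⟨f ∘ H, hf.comp hH, fun s => congrArg f (h0 s), fun s => congrArg f (h1 s),
    fun t => congrArg f (h2 t), fun t => congrArg f (h3 t)⟩

theorem map_star {f : X → Y} (hf : IsCont c c' f) (γ δ : Loop c x) :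
    (γ.star δ).map f hf = (γ.map f hf).star (δ.map f hf) := by
  ext t
  exact apply_ite f _ _ _

/-- Homotopy relative to the end points, as an equivalence relation on loops. -/
def setoid (c : CechClosure X) (x : X) : Setoid (Loop c x) where
  r := Homotopic
  iseqv := ⟨Homotopic.refl, Homotopic.symm, Homotopic.trans⟩

end Loop

/-- The fundamental group of the closure space `(X, c)` at the base point `x`. -/
def PiOne (c : CechClosure X) (x : X) : Type _ := Quotient (Loop.setoid c x)

/-- The class `[v]` of a loop. -/
def PiOne.mk {c : CechClosure X} {x : X} (v : Loop c x) : PiOne c x :=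
  Quotient.mk (Loop.setoid c x) v

/-- The product of the fundamental group is `[v] * [w] = [v ⋆ w]`. -/
noncomputable instance (c : CechClosure X) (x : X) : Group (PiOne c x) :=
  letI : Mul (PiOne c x) := ⟨Quotient.map₂ Loop.star fun _ _ h _ _ h' => h.star h'⟩
  letI : One (PiOne c x) := ⟨Quotient.mk _ (Loop.const c x)⟩
  letI : Inv (PiOne c x) := ⟨Quotient.map Loop.reverse fun _ _ h => h.reverse⟩
  Group.ofLeftAxioms
    (by rintro ⟨a⟩ ⟨b⟩ ⟨d⟩; exact Quotient.sound (Loop.star_assoc a b d))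
    (by rintro ⟨a⟩; exact Quotient.sound (Loop.const_star a))
    (by rintro ⟨a⟩; exact Quotient.sound (Loop.reverse_star a))

/-- The homomorphism of fundamental groups that a continuous map `f` induces, `[γ] ↦ [f ∘ γ]`. -/
noncomputable def PiOne.map {c : CechClosure X} {c' : CechClosure Y} (f : X → Y)
    (hf : IsCont c c' f) (x : X) : PiOne c x →* PiOne c' (f x) :=
  MonoidHom.mk' (Quotient.map (Loop.map f hf) fun _ _ h => h.map hf) (by
    rintro ⟨a⟩ ⟨b⟩
    exact congrArg (Quotient.mk _) (Loop.map_star hf a b))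

theorem PiOne.mk_mul_mk {c : CechClosure X} {x : X} (v w : Loop c x) :
    PiOne.mk v * PiOne.mk w = PiOne.mk (v.star w) := rfl

theorem PiOne.map_mk {c : CechClosure X} {c' : CechClosure Y} {f : X → Y}
    (hf : IsCont c c' f) {x : X} (γ : Loop c x) :
    PiOne.map f hf x (PiOne.mk γ) = PiOne.mk (γ.map f hf) := rfl

/-- The closure structure `c_{m,n}` on `ℤ/n`: the closure of a point `k` is
`{k - m, …, k, …, k + m}`, and the closure of a set is the union of those of its points. -/
def cyc (m n : ℕ) : CechClosure (ZMod n) where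
  cl A := ⋃ k ∈ A, {x | ∃ j : ℤ, -(m : ℤ) ≤ j ∧ j ≤ m ∧ x = k + (j : ZMod n)}
  cl_empty := by simp
  subset_cl A k hk := Set.mem_biUnion hk ⟨0, by simp, by simp, by simp⟩
  cl_union A B := Set.biUnion_union _ _ _

theorem nearest_periodic (n : ℕ) :
    Function.Periodic (fun t : ℝ => ((⌊n * t + 1 / 2⌋ : ℤ) : ZMod n)) 1 := by
  intro t
  have : (n * (t + 1) + 1 / 2 : ℝ) = (n * t + 1 / 2) + (n : ℕ) := by ring
  simp only [this, Int.floor_add_natCast]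
  simp

/-- The nearest neighbor map `f : S¹ = ℝ/ℤ → ℤ/n`; it is pinned down by `nearest_eq` below. -/
noncomputable def nearest (n : ℕ) : UnitAddCircle → ZMod n := (nearest_periodic n).lift

/-- `f t = i` for `t ∈ [(2i-1)/(2n), (2i+1)/(2n))`, intervals being taken mod `1`. -/
theorem nearest_eq (n : ℕ) (hn : 0 < n) (i : ℤ) (t : ℝ)
    (ht : t ∈ Set.Ico ((2 * i - 1 : ℝ) / (2 * n)) ((2 * i + 1 : ℝ) / (2 * n))) :
    nearest n (t : UnitAddCircle) = (i : ZMod n) := by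
  have hn' : (0 : ℝ) < 2 * n := by positivity
  obtain ⟨h1, h2⟩ := ht
  rw [div_le_iff₀ hn'] at h1
  rw [lt_div_iff₀ hn'] at h2
  have : ⌊n * t + 1 / 2⌋ = i := by
    rw [Int.floor_eq_iff]
    constructor <;> linarith
  rw [nearest, Function.Periodic.lift_coe, this]

end CechClosure

namespace CechClosure

open scoped unitInterval Topology
open Filter

variable {T S : Type*} [TopologicalSpace T] [TopologicalSpace S] {m n : ℕ}

/-! The projection from `line m` to `cyc m n` acts as a universal cover for maps out of the square.
Near a point such a map stays in a ball of radius `m`; two of its points are at most `2m` apart, a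
step adds at most `m`, and since `3m < n` residues determine the integers involved. So lifts exist
locally, are unique up to a constant (`sub_eq_sub_of_cast_eq`), and glue over a fine grid
(`exists_isLift_square`). The map `nearest n` lifts to `⌊n * t + 1 / 2⌋`.

Injectivity: lift a null homotopy of the image of a loop. The lift is constant on three sides of the
square, so its ends on the fourth agree; hence the real lift of the loop closes up and contracts
linearly.

Surjectivity: lift a loop to an integer path, approximate it by a continuous real path
(`exists_continuous_floor_near`), and jump from the former to the floor of the latter
(`isCont_jump`). The rescaled real path projects to the required loop. -/

/-! ### Continuity in terms of neighborhoods, and the line over the cycle. -/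

theorem continuous_of_isCont {f : T → S} (hf : IsCont (ofTop T) (ofTop S) f) : Continuous f := by
  refine continuous_iff_continuousAt.2 fun x => ?_
  intro V hV
  by_contra h
  have hx : x ∈ closure (f ⁻¹' V)ᶜ := by rwa [closure_compl, Set.mem_compl_iff,
    mem_interior_iff_mem_nhds]
  obtain ⟨y, hy, t, ht, rfl⟩ := mem_closure_iff_nhds.1 (hf x _ hx) V hV
  exact ht hy

theorem isCont_cyc_iff {f : T → ZMod n} :
    IsCont (ofTop T) (cyc m n) f ↔
      ∀ x, ∀ᶠ t in 𝓝 x, ∃ j : ℤ, |j| ≤ m ∧ f t = f x + (j : ZMod n) := by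
  constructor
  · intro hf x
    by_contra h
    have hx : x ∈ closure {t | ∃ j : ℤ, |j| ≤ m ∧ f t = f x + (j : ZMod n)}ᶜ := by
      rwa [closure_compl, Set.mem_compl_iff, mem_interior_iff_mem_nhds]
    obtain ⟨k, ⟨t, ht, rfl⟩, j, hj1, hj2, hj⟩ := Set.mem_iUnion₂.1 (hf x _ hx)
    exact ht ⟨-j, by rw [abs_neg]; exact abs_le.2 ⟨hj1, hj2⟩, by rw [hj]; push_cast; ring⟩
  · intro hf x U hx
    obtain ⟨t, ⟨j, hj, e⟩, ht⟩ := mem_closure_iff_nhds.1 hx _ (hf x)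
    obtain ⟨hj1, hj2⟩ := abs_le.1 hj
    exact Set.mem_iUnion₂.2 ⟨f t, ⟨t, ht, rfl⟩, -j, by omega, by omega, by rw [e]; push_cast; ring⟩

/-- The closure structure on `ℤ` for which the closure of `k` is `{k - m, …, k + m}`. -/
def line (m : ℕ) : CechClosure ℤ where
  cl A := ⋃ k ∈ A, {x | |x - k| ≤ m}
  cl_empty := by simp
  subset_cl A k hk := Set.mem_biUnion hk (by simp)
  cl_union A B := Set.biUnion_union _ _ _

theorem isCont_line_iff {f : T → ℤ} :
    IsCont (ofTop T) (line m) f ↔ ∀ x, ∀ᶠ t in 𝓝 x, |f t - f x| ≤ m := by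
  constructor
  · intro hf x
    by_contra h
    have hx : x ∈ closure {t | |f t - f x| ≤ m}ᶜ := by
      rwa [closure_compl, Set.mem_compl_iff, mem_interior_iff_mem_nhds]
    obtain ⟨k, ⟨t, ht, rfl⟩, hj⟩ := Set.mem_iUnion₂.1 (hf x _ hx)
    exact ht (by rwa [Set.mem_ofPred_eq, abs_sub_comm])
  · intro hf x U hx
    obtain ⟨t, ht', ht⟩ := mem_closure_iff_nhds.1 hx _ (hf x)
    exact Set.mem_iUnion₂.2 ⟨f t, ⟨t, ht, rfl⟩, by
      rw [Set.mem_ofPred_eq, abs_sub_comm]; exact ht'⟩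

theorem isCont_line_cast : IsCont (line m) (cyc m n) (fun k : ℤ => (k : ZMod n)) := by
  intro x U hx
  obtain ⟨k, hk, h⟩ := Set.mem_iUnion₂.1 hx
  obtain ⟨h1, h2⟩ := abs_le.1 (show |x - k| ≤ m from h)
  exact Set.mem_iUnion₂.2 ⟨k, ⟨k, hk, rfl⟩, x - k, h1, h2, by push_cast; ring⟩

theorem isCont_line_add (a : ℤ) : IsCont (line m) (line m) (fun k => k + a) := by
  intro x U hx
  obtain ⟨k, hk, h⟩ := Set.mem_iUnion₂.1 hx
  exact Set.mem_iUnion₂.2 ⟨k + a, ⟨k, hk, rfl⟩, by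
    rw [Set.mem_ofPred_eq, add_sub_add_right_eq_sub]; exact h⟩

theorem int_eq_of_cast_eq {a b : ℤ} (h : (a : ZMod n) = b) (hab : |a - b| < n) : a = b := by
  have hd : (n : ℤ) ∣ a - b := by
    rw [← ZMod.intCast_zmod_eq_zero_iff_dvd, Int.cast_sub, h, sub_self]
  exact sub_eq_zero.1 (Int.eq_zero_of_abs_lt_dvd hd hab)

/-! ### Lifts: uniqueness, local existence, gluing. -/

/-- `L` is a continuous lift of `H` along the projection `ℤ → ℤ/n`. -/
structure IsLift (m : ℕ) (H : T → ZMod n) (L : T → ℤ) : Prop where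
  cont : IsCont (ofTop T) (line m) L
  cast : ∀ t, (L t : ZMod n) = H t

theorem IsLift.comp {H : T → ZMod n} {L : T → ℤ} (h : IsLift m H L) {φ : S → T}
    (hφ : Continuous φ) : IsLift m (H ∘ φ) (L ∘ φ) :=
  ⟨h.cont.comp (isCont_ofTop hφ), fun _ => h.cast _⟩

/-- Two lifts of a map on a connected space differ by a constant. -/
theorem sub_eq_sub_of_cast_eq [PreconnectedSpace T] (hmn : 3 * m < n) {L L' : T → ℤ}
    (hL : IsCont (ofTop T) (line m) L) (hL' : IsCont (ofTop T) (line m) L')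
    (h : ∀ t, (L t : ZMod n) = L' t) (x y : T) : L x - L' x = L y - L' y := by
  have hl : IsLocallyConstant fun t => L t - L' t := by
    refine (IsLocallyConstant.iff_eventually_eq _).2 fun x => ?_
    filter_upwards [isCont_line_iff.1 hL x, isCont_line_iff.1 hL' x] with t h1 h2
    -- The difference is a multiple of `n` and moves by at most `2m < n` near `x`.
    refine int_eq_of_cast_eq (n := n) (by simp [h]) ?_
    rw [abs_le] at h1 h2
    rw [abs_lt]
    omega
  exact hl.apply_eq_of_preconnectedSpace x y

/-- A continuous map with values in a ball of radius `m` has a lift. -/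
theorem exists_isLift_of_forall_near (hmn : 3 * m < n) {H : T → ZMod n}
    (hH : IsCont (ofTop T) (cyc m n) H) (y : ZMod n)
    (hy : ∀ t, ∃ j : ℤ, |j| ≤ m ∧ H t = y + (j : ZMod n)) : ∃ L, IsLift m H L := by
  choose j hj e using hy
  obtain ⟨b, rfl⟩ := ZMod.intCast_surjective y
  refine ⟨fun t => b + j t, isCont_line_iff.2 fun x => ?_, fun t => by rw [e]; push_cast; rfl⟩
  filter_upwards [isCont_cyc_iff.1 hH x] with t ⟨i, hi, ht⟩
  -- Both sides agree mod `n` and differ by at most `3m`: the full bound `3m < n` is needed here.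
  have : j t = j x + i := by
    refine int_eq_of_cast_eq (n := n) ?_ ?_
    · rw [e t, e x, add_assoc] at ht
      push_cast
      exact add_left_cancel ht
    · have h1 := abs_le.1 (hj t)
      have h2 := abs_le.1 (hj x)
      have h3 := abs_le.1 hi
      rw [abs_lt]
      omega
  rw [this]
  simpa using hi

/-- Gluing of lifts along a connected set `r = 1/2`. -/
theorem exists_isLift_glue (hmn : 3 * m < n) {H H₁ H₂ : T → ZMod n} {r : T → ℝ}
    (hr : Continuous r) (h1 : ∀ t, r t ≤ 1 / 2 → H t = H₁ t) (h2 : ∀ t, 1 / 2 ≤ r t → H t = H₂ t)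
    (hc : IsPreconnected {t | r t = 1 / 2}) (hL₁ : ∃ L, IsLift m H₁ L) (hL₂ : ∃ L, IsLift m H₂ L) :
    ∃ L, IsLift m H L := by
  obtain ⟨L₁, hL₁⟩ := hL₁
  obtain ⟨L₂, hL₂⟩ := hL₂
  -- On the seam both are lifts of `H`, so by connectedness one translate of `L₂` matches `L₁`
  -- there.
  have key : ∃ a : ℤ, (a : ZMod n) = 0 ∧ ∀ t, r t = 1 / 2 → L₁ t = L₂ t + a := by
    rcases Set.eq_empty_or_nonempty {t | r t = 1 / 2} with he | ⟨t₀, ht₀⟩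
    · exact ⟨0, by simp, fun t ht => absurd ht (Set.eq_empty_iff_forall_notMem.1 he t)⟩
    · refine ⟨L₁ t₀ - L₂ t₀, ?_, fun t ht => ?_⟩
      · rw [Int.cast_sub, hL₁.cast, hL₂.cast, ← h1 _ (le_of_eq ht₀), ← h2 _ (ge_of_eq ht₀), sub_self]
      · have : PreconnectedSpace {t // r t = 1 / 2} := Subtype.preconnectedSpace hc
        have hv := isCont_ofTop (continuous_subtype_val (p := fun t => r t = 1 / 2))
        have := sub_eq_sub_of_cast_eq hmn (hL₁.cont.comp hv) (hL₂.cont.comp hv)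
          (fun s => by
            simp only [Function.comp, hL₁.cast, hL₂.cast]
            rw [← h1 _ (le_of_eq s.2), ← h2 _ (ge_of_eq s.2)]) ⟨t, ht⟩ ⟨t₀, ht₀⟩
        simp only [Function.comp] at this
        omega
  obtain ⟨a, ha, hLa⟩ := key
  refine ⟨fun t => if r t ≤ 1 / 2 then L₁ t else L₂ t + a,
    isCont_glue hr hL₁.cont ((isCont_line_add a).comp hL₂.cont) hLa, fun t => ?_⟩
  split_ifs with h
  · rw [hL₁.cast, h1 t h]
  · rw [Int.cast_add, ha, hL₂.cast, add_zero, h2 t (le_of_not_ge h)]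

/-! ### Lifting over the square and the interval. -/

/-- The nearest point retraction of `[0,1]` onto `[a,b]`. -/
def retr (a b s : I) : I := max a (min b s)

theorem continuous_retr (a b : I) : Continuous (retr a b) := by unfold retr; fun_prop

theorem retr_mem {a b : I} (h : a ≤ b) (s : I) : retr a b s ∈ Set.Icc a b :=
  ⟨le_max_left _ _, max_le h (min_le_left _ _)⟩

theorem retr_of_le {a b d s : I} (hbd : b ≤ d) (h : s ≤ b) : retr a d s = retr a b s := by
  rw [retr, retr, min_eq_right h, min_eq_right (h.trans hbd)]

theorem retr_of_ge {a b d s : I} (hab : a ≤ b) (hbd : b ≤ d) (h : b ≤ s) :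
    retr a d s = retr b d s := by
  rw [retr, retr, max_eq_right (hab.trans (le_min hbd h)), max_eq_right (le_min hbd h)]

/-- Precomposing with `retr` keeps all maps defined on the whole square, so that adjacent strips
meet along the connected segment `{b} × I`. -/
theorem exists_isLift_glue_fst (hmn : 3 * m < n) (H : I × I → ZMod n) {a b d : I} (hab : a ≤ b)
    (hbd : b ≤ d) (φ : I → I)
    (h1 : ∃ L, IsLift m (fun p : I × I => H (retr a b p.1, φ p.2)) L)
    (h2 : ∃ L, IsLift m (fun p : I × I => H (retr b d p.1, φ p.2)) L) :
    ∃ L, IsLift m (fun p : I × I => H (retr a d p.1, φ p.2)) L := by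
  refine exists_isLift_glue hmn (r := fun p : I × I => (p.1 : ℝ) - b + 1 / 2) (by fun_prop)
    (fun p hp => ?_) (fun p hp => ?_) ?_ h1 h2
  · rw [retr_of_le hbd (Subtype.coe_le_coe.1 (by linarith))]
  · rw [retr_of_ge hab hbd (Subtype.coe_le_coe.1 (by linarith))]
  · have : {p : I × I | (p.1 : ℝ) - b + 1 / 2 = 1 / 2} = {b} ×ˢ Set.univ := by
      ext p
      simp [sub_eq_zero, Subtype.ext_iff]
    rw [this]
    exact isPreconnected_singleton.prod isPreconnected_univ

theorem exists_isLift_glue_snd (hmn : 3 * m < n) (H : I × I → ZMod n) {a b d : I} (hab : a ≤ b)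
    (hbd : b ≤ d) (φ : I → I)
    (h1 : ∃ L, IsLift m (fun p : I × I => H (φ p.1, retr a b p.2)) L)
    (h2 : ∃ L, IsLift m (fun p : I × I => H (φ p.1, retr b d p.2)) L) :
    ∃ L, IsLift m (fun p : I × I => H (φ p.1, retr a d p.2)) L := by
  obtain ⟨L₁, h1⟩ := h1
  obtain ⟨L₂, h2⟩ := h2
  obtain ⟨L, h⟩ := exists_isLift_glue_fst hmn (H ∘ Prod.swap) hab hbd φ
    ⟨_, h1.comp continuous_swap⟩ ⟨_, h2.comp continuous_swap⟩
  exact ⟨_, h.comp continuous_swap⟩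

/-- Every continuous map from the square to `(ℤ/n, c_{m,n})` lifts to `ℤ`. -/
theorem exists_isLift_square (hmn : 3 * m < n) {H : I × I → ZMod n}
    (hH : IsCont (ofTop (I × I)) (cyc m n) H) : ∃ L, IsLift m H L := by
  -- A Lebesgue number argument: on each grid cell `H` stays within `m` of a single value.
  obtain ⟨t, t0, tmono, ⟨N, hN⟩, hsub⟩ :=
    exists_monotone_Icc_subset_open_cover_unitInterval_prod_self
      (c := fun p => interior {q | ∃ j : ℤ, |j| ≤ m ∧ H q = H p + (j : ZMod n)})
      (fun _ => isOpen_interior)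
      (fun p _ => Set.mem_iUnion.2 ⟨p, mem_interior_iff_mem_nhds.2 (isCont_cyc_iff.1 hH p)⟩)
  have cell : ∀ i j, ∃ L, IsLift m
      (fun p : I × I => H (retr (t i) (t (i + 1)) p.1, retr (t j) (t (j + 1)) p.2)) L := by
    intro i j
    obtain ⟨q, hq⟩ := hsub i j
    refine exists_isLift_of_forall_near hmn (hH.comp (isCont_ofTop
      (f := fun p : I × I => (retr (t i) (t (i + 1)) p.1, retr (t j) (t (j + 1)) p.2)) ?_)) (H q)
      fun p => (interior_subset (hq (Set.mk_mem_prod (retr_mem (tmono i.le_succ) p.1)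
        (retr_mem (tmono j.le_succ) p.2))) :)
    exact ((continuous_retr _ _).comp continuous_fst).prodMk
      ((continuous_retr _ _).comp continuous_snd)
  have row : ∀ i j, ∃ L, IsLift m
      (fun p : I × I => H (retr (t 0) (t (i + 1)) p.1, retr (t j) (t (j + 1)) p.2)) L := by
    intro i j
    induction i with
    | zero => exact cell 0 j
    | succ i ih =>
      exact exists_isLift_glue_fst hmn H (tmono (Nat.zero_le _)) (tmono (Nat.le_succ _)) _ ih
        (cell (i + 1) j)
  have all : ∀ i j, ∃ L, IsLift m
      (fun p : I × I => H (retr (t 0) (t (i + 1)) p.1, retr (t 0) (t (j + 1)) p.2)) L := by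
    intro i j
    induction j with
    | zero => exact row i 0
    | succ j ih =>
      exact exists_isLift_glue_snd hmn H (tmono (Nat.zero_le _)) (tmono (Nat.le_succ _)) _ ih
        (row i (j + 1))
  have hid : ∀ s : I, retr 0 1 s = s := fun s => by
    rw [retr, min_eq_right unitInterval.le_one', max_eq_right unitInterval.nonneg']
  simpa [t0, hN (N + 1) N.le_succ, hid] using all N N

/-- Lift `γ ∘ Prod.fst` over the square, restrict to the bottom side, and translate by a multiple of
`n`. -/
theorem exists_isLift_interval (hmn : 3 * m < n) {γ : I → ZMod n}
    (hγ : IsCont (ofTop I) (cyc m n) γ) (a : ℤ) (ha : (a : ZMod n) = γ 0) :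
    ∃ L, IsLift m γ L ∧ L 0 = a := by
  obtain ⟨L, hL⟩ := exists_isLift_square hmn
    (hγ.comp (isCont_ofTop (continuous_fst : Continuous (Prod.fst : I × I → I))))
  have hL' := hL.comp (φ := fun s : I => (s, (0 : I))) (by fun_prop)
  refine ⟨fun s => L (s, 0) + (a - L (0, 0)), ⟨(isCont_line_add _).comp hL'.cont, fun s => ?_⟩,
    by simp⟩
  rw [Int.cast_add, Int.cast_sub, hL.cast, hL.cast, ha]
  simp

/-! ### Floors of real functions, and approximation of integer paths. -/

theorem abs_floor_sub_floor_le_one {r s : ℝ} (h : |r - s| < 1) : |⌊r⌋ - ⌊s⌋| ≤ 1 := by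
  obtain ⟨h1, h2⟩ := abs_lt.1 h
  have a1 := Int.floor_le r
  have a2 := Int.lt_floor_add_one r
  have b1 := Int.floor_le s
  have b2 := Int.lt_floor_add_one s
  rw [abs_le]
  constructor
  · have : (⌊s⌋ : ℝ) < ⌊r⌋ + 2 := by linarith
    have : ⌊s⌋ < ⌊r⌋ + 2 := by exact_mod_cast this
    omega
  · have : (⌊r⌋ : ℝ) < ⌊s⌋ + 2 := by linarith
    have : ⌊r⌋ < ⌊s⌋ + 2 := by exact_mod_cast this
    omega

theorem isCont_line_floor (hm : 1 ≤ m) {g : T → ℝ} (hg : Continuous g) :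
    IsCont (ofTop T) (line m) (fun t => ⌊g t⌋) := by
  refine isCont_line_iff.2 fun x => ?_
  filter_upwards [hg.continuousAt.eventually (Metric.ball_mem_nhds (g x) one_pos)] with t ht
  exact (abs_floor_sub_floor_le_one ht).trans (by exact_mod_cast hm)

theorem nearest_coe (n : ℕ) (t : ℝ) :
    nearest n (t : UnitAddCircle) = ((⌊n * t + 1 / 2⌋ : ℤ) : ZMod n) := rfl

/-- Neighborhoods in the circle are pushed forward from `ℝ`, where the floor jumps locally by at
most `1 ≤ m`. -/
theorem isCont_nearest (hm : 1 ≤ m) : IsCont (ofTop UnitAddCircle) (cyc m n) (nearest n) := by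
  refine isCont_cyc_iff.2 fun x => ?_
  induction x using QuotientAddGroup.induction_on with | _ a => ?_
  have h := isCont_cyc_iff.1 ((isCont_line_cast (n := n)).comp (isCont_line_floor hm
    (g := fun t : ℝ => n * t + 1 / 2) (by fun_prop))) a
  rw [QuotientAddGroup.nhds_eq, eventually_map]
  exact h

/-- A continuous map from the interval to `ℤ` is approximated by a continuous real function with
prescribed values at the end points. -/
theorem exists_continuous_floor_near {L : I → ℤ} (hL : IsCont (ofTop I) (line m) L) {u v : ℝ}
    (hu : ⌊u⌋ = L 0) (hv : ⌊v⌋ = L 1) :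
    ∃ g : C(I, ℝ), g 0 = u ∧ g 1 = v ∧ ∀ s, ∀ᶠ s' in 𝓝 s, |⌊g s⌋ - L s'| ≤ m := by
  -- The end values join the pointwise constraint, so that one selection by a partition of unity
  -- meets everything.
  suffices h : ∃ g : C(I, ℝ), ∀ s, g s ∈
      {r | (∀ᶠ s' in 𝓝 s, |⌊r⌋ - L s'| ≤ m) ∧ (s = 0 → r = u) ∧ (s = 1 → r = v)} by
    obtain ⟨g, hg⟩ := h
    exact ⟨g, (hg 0).2.1 rfl, (hg 1).2.2 rfl, fun s => (hg s).1⟩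
  refine exists_continuous_forall_mem_convex_of_local_const (fun s => ?_) (fun s => ?_)
  -- In `ℝ` convexity is order convexity, and the floor is monotone.
  · refine convex_iff_ordConnected.2 ⟨?_⟩
    rintro r ⟨h1, h2, h3⟩ r' ⟨h1', h2', h3'⟩ c ⟨hc, hc'⟩
    refine ⟨?_, fun h => le_antisymm (hc'.trans_eq (h2' h)) ((h2 h).ge.trans hc),
      fun h => le_antisymm (hc'.trans_eq (h3' h)) ((h3 h).ge.trans hc)⟩
    filter_upwards [h1, h1'] with s' k k'
    have e := Int.floor_mono hc
    have e' := Int.floor_mono hc'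
    rw [abs_le] at k k' ⊢
    omega
  -- A constant with floor `L s` works near `s`; an end condition is void close to any `s` other
  -- than that end.
  · have key : ∀ c : ℝ, ⌊c⌋ = L s → (s = 0 → c = u) → (s = 1 → c = v) → ∀ᶠ y in 𝓝 s,
        c ∈ {r | (∀ᶠ s' in 𝓝 y, |⌊r⌋ - L s'| ≤ m) ∧ (y = 0 → r = u) ∧ (y = 1 → r = v)} := by
      intro c hc h0 h1
      have hne : ∀ (z : I) (w : ℝ), (s = z → c = w) → ∀ᶠ y in 𝓝 s, y = z → c = w := by
        intro z w h
        by_cases hs : s = z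
        · exact Eventually.of_forall fun _ _ => h hs
        · filter_upwards [isOpen_ne.mem_nhds hs] with y hy hy'
          exact absurd hy' hy
      filter_upwards [eventually_eventually_nhds.2 (isCont_line_iff.1 hL s), hne 0 u h0,
        hne 1 v h1] with y hy h2 h3
      refine ⟨hy.mono fun s' h => ?_, h2, h3⟩
      rwa [hc, abs_sub_comm]
    by_cases h0 : s = 0
    · exact ⟨u, key u (h0 ▸ hu) (fun _ => rfl) (fun h => by simp [h0] at h)⟩
    by_cases h1 : s = 1
    · exact ⟨v, key v (h1 ▸ hv) (fun h => absurd h h0) (fun _ => rfl)⟩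
    exact ⟨L s, key _ (Int.floor_intCast _) (fun h => absurd h h0) (fun h => absurd h h1)⟩

/-- Maps that are close to each other are homotopic, by a homotopy that jumps at time `1`. -/
theorem isCont_jump {L K : I → ℤ} (hL : IsCont (ofTop I) (line m) L)
    (hK : IsCont (ofTop I) (line m) K) (h : ∀ s, ∀ᶠ s' in 𝓝 s, |K s - L s'| ≤ m) :
    IsCont (ofTop (I × I)) (line m) (fun p => if p.2 = 1 then K p.1 else L p.1) := by
  refine isCont_line_iff.2 fun ⟨s, t⟩ => ?_
  by_cases ht : t = 1
  · subst ht
    have hf : Tendsto Prod.fst (𝓝 (s, (1 : I))) (𝓝 s) := continuous_fst.tendsto _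
    filter_upwards [hf.eventually (h s), hf.eventually (isCont_line_iff.1 hK s)] with p h1 h2
    simp only [if_true]
    split_ifs
    · exact h2
    · rwa [abs_sub_comm]
  -- Times other than `1` form an open set, so only `L` is seen nearby; closeness of `K` to `L`
  -- matters at time `1` alone.
  · have hf : Tendsto Prod.fst (𝓝 (s, t)) (𝓝 s) := continuous_fst.tendsto _
    have hs : Tendsto Prod.snd (𝓝 (s, t)) (𝓝 t) := continuous_snd.tendsto _
    filter_upwards [hf.eventually (isCont_line_iff.1 hL s), hs.eventually (isOpen_ne.mem_nhds ht)]
      with p h1 h2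
    simpa [ht, if_neg h2] using h1

/-! ### Loops in the circle as projected real paths. -/

/-- The loop in the circle that a path in `ℝ` projects to. -/
def circleLoop (g : C(I, ℝ)) {x : UnitAddCircle} (h0 : (g 0 : UnitAddCircle) = x)
    (h1 : (g 1 : UnitAddCircle) = x) : Loop (ofTop UnitAddCircle) x where
  toFun s := (g s : UnitAddCircle)
  cont := isCont_ofTop (f := fun s => (g s : UnitAddCircle))
    ((AddCircle.continuous_mk' 1).comp g.continuous)
  zero := h0
  one := h1

theorem exists_eq_circleLoop {x : UnitAddCircle} (α : Loop (ofTop UnitAddCircle) x) :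
    ∃ (g : C(I, ℝ)) (h0 : (g 0 : UnitAddCircle) = x) (h1 : (g 1 : UnitAddCircle) = x),
      α = circleLoop g h0 h1 := by
  obtain ⟨e, he⟩ := QuotientAddGroup.mk_surjective x
  obtain ⟨g, hg, -⟩ := (AddCircle.isCoveringMap_coe (1 : ℝ)).exists_path_lifts
    ⟨α.toFun, continuous_of_isCont α.cont⟩ e (α.zero.trans he.symm)
  have hg' : ∀ s, (g s : UnitAddCircle) = α.toFun s := congrFun hg
  exact ⟨g, (hg' 0).trans α.zero, (hg' 1).trans α.one, Loop.ext (funext fun s => (hg' s).symm)⟩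

/-- Contract linearly to `g 0` in `ℝ`; both ends stay fixed because `g 1 = g 0`. -/
theorem circleLoop_homotopic_const (g : C(I, ℝ)) {x : UnitAddCircle}
    (h0 : (g 0 : UnitAddCircle) = x) (h1 : (g 1 : UnitAddCircle) = x) (h : g 1 = g 0) :
    (circleLoop g h0 h1).Homotopic (Loop.const _ x) := by
  refine ⟨fun p => ((((1 - p.2) * g p.1 + p.2 * g 0 : ℝ)) : UnitAddCircle), ?_, fun s => ?_,
    fun s => ?_, fun t => ?_, fun t => ?_⟩
  · rw [prod_ofTop]
    exact isCont_ofTop ((AddCircle.continuous_mk' 1).comp (by fun_prop))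
  · simp [circleLoop]
  · simp [Loop.const, h0]
  · beta_reduce
    rw [← h0, ← add_mul, sub_add_cancel, one_mul]
  · beta_reduce
    rw [h, ← h0, ← add_mul, sub_add_cancel, one_mul]

/-! ### Injectivity and surjectivity of the induced map. -/

theorem map_nearest_injective (hm : 1 ≤ m) (hmn : 3 * m < n) (x : UnitAddCircle) :
    Function.Injective (PiOne.map (nearest n) (isCont_nearest (n := n) hm) x) := by
  rw [injective_iff_map_eq_one]
  rintro ⟨α⟩ hα
  obtain ⟨g, h0, h1, rfl⟩ := exists_eq_circleLoop α
  obtain ⟨H, hH, H0, H1, H2, H3⟩ := Quotient.exact (s := Loop.setoid _ _) hα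
  refine Quotient.sound (s := Loop.setoid _ _) (circleLoop_homotopic_const g h0 h1 ?_)
  rw [prod_ofTop] at hH
  obtain ⟨L, hL⟩ := exists_isLift_square hmn hH
  -- Where `H` is constant, a constant integer is also a lift, so uniqueness makes `L` constant.
  have edge : ∀ φ : I → I × I, Continuous φ → (∀ s, H (φ s) = nearest n x) →
      L (φ 0) = L (φ 1) := by
    intro φ hφ hx
    obtain ⟨b, hb⟩ := ZMod.intCast_surjective (nearest n x)
    have := sub_eq_sub_of_cast_eq hmn (hL.cont.comp (isCont_ofTop hφ))
      (L' := fun _ => b) (isCont_line_iff.2 fun _ => by simp)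
      (fun s => by simp [hL.cast, hx, hb]) 0 1
    simpa using this
  have e1 : L (0, 0) = L (0, 1) := edge (fun t => (0, t)) (by fun_prop) H2
  have e2 : L (0, 1) = L (1, 1) := edge (fun s => (s, 1)) (by fun_prop) H1
  have e3 : L (1, 0) = L (1, 1) := edge (fun t => (1, t)) (by fun_prop) H3
  -- On the bottom side `L` and the floor of `n * g + 1 / 2` lift the same loop, hence rise equally.
  have e4 := sub_eq_sub_of_cast_eq hmn (n := n)
    (hL.cont.comp (isCont_ofTop (f := fun s : I => (s, (0 : I))) (by fun_prop)))
    (isCont_line_floor hm (g := fun s : I => n * g s + 1 / 2) (by fun_prop))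
    (fun s => by rw [Function.comp, hL.cast, H0]; rfl) 0 1
  simp only [Function.comp] at e4
  obtain ⟨k, hk⟩ : ∃ k : ℤ, g 1 = g 0 + k := by
    have : ((g 1 - g 0 : ℝ) : UnitAddCircle) = 0 := by rw [AddCircle.coe_sub, h0, h1, sub_self]
    obtain ⟨k, hk⟩ := (AddCircle.coe_eq_zero_iff 1).1 this
    exact ⟨k, by simp at hk; linarith⟩
  have e5 : (n * g 1 + 1 / 2 : ℝ) = (n * g 0 + 1 / 2) + ((n * k : ℤ) : ℝ) := by
    rw [hk]; push_cast; ring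
  rw [e5, Int.floor_add_intCast] at e4
  have hnk : (n : ℤ) * k = 0 := by linarith
  have : k = 0 := (mul_eq_zero.1 hnk).resolve_left (by omega)
  simp [hk, this]

theorem map_nearest_surjective (hm : 1 ≤ m) (hmn : 3 * m < n) (x : UnitAddCircle) :
    Function.Surjective (PiOne.map (nearest n) (isCont_nearest (n := n) hm) x) := by
  rintro ⟨γ⟩
  obtain ⟨e, rfl⟩ := QuotientAddGroup.mk_surjective x
  have hn : (n : ℝ) ≠ 0 := by
    have : n ≠ 0 := by omega
    exact_mod_cast this
  obtain ⟨L, hL, hL0⟩ := exists_isLift_interval hmn γ.cont ⌊n * e + 1 / 2⌋ γ.zero.symm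
  obtain ⟨k, hk⟩ : ∃ k : ℤ, L 1 = L 0 + n * k := by
    have : (L 0 : ZMod n) = L 1 := by rw [hL.cast, hL.cast, γ.zero, γ.one]
    obtain ⟨k, hk⟩ := (ZMod.intCast_eq_intCast_iff_dvd_sub _ _ _).1 this
    exact ⟨k, by linarith⟩
  -- The end values are the images of `e` and `e + k` under `t ↦ n * t + 1 / 2`, which `g'` inverts;
  -- both project to the base point.
  obtain ⟨g, g0, g1, hg⟩ := exists_continuous_floor_near hL.cont (u := n * e + 1 / 2)
    (v := n * e + 1 / 2 + ((n * k : ℤ) : ℝ)) hL0.symm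
    (by rw [Int.floor_add_intCast, hk, hL0])
  let g' : C(I, ℝ) := ⟨fun s => (g s - 1 / 2) / n, by fun_prop⟩
  have hg' : ∀ s, n * g' s + 1 / 2 = g s := fun s => by
    simp only [g', ContinuousMap.coe_mk]; field_simp; ring
  have h0 : g' 0 = e := by
    simp only [g', ContinuousMap.coe_mk, g0]; field_simp; ring
  have h1 : g' 1 = e + k := by
    simp only [g', ContinuousMap.coe_mk, g1]; push_cast; field_simp; ring
  have hk0 : ((k : ℝ) : UnitAddCircle) = 0 := (AddCircle.coe_eq_zero_iff 1).2 ⟨k, by simp⟩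
  refine ⟨PiOne.mk (circleLoop g' (by rw [h0])
    (by rw [h1, AddCircle.coe_add, hk0, add_zero])), ?_⟩
  refine Quotient.sound (s := Loop.setoid _ _) (Loop.Homotopic.symm ?_)
  have hF := (isCont_line_cast (n := n)).comp
    (isCont_jump hL.cont (isCont_line_floor hm g.continuous) hg)
  refine ⟨_, by rw [prod_ofTop]; exact hF, fun s => ?_, fun s => ?_, fun t => ?_, fun t => ?_⟩
  · simp [hL.cast]
  · simp only [Function.comp, if_true, Loop.map, circleLoop, nearest_coe, hg']
  · simp [g0, hL0, nearest_coe]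
  -- The integer path and the floor agree at the end, so the jump is invisible on this side.
  · have e1 : L 1 = ⌊g 1⌋ := by rw [g1, Int.floor_add_intCast, hk, hL0]
    simp only [Function.comp, e1, ite_self]
    rw [← e1, hL.cast, γ.one]

end CechClosure

theorem mainTheorem4 (m n : ℕ) (h3 : 3 ≤ 3 * m) (hmn : 3 * m < n) :
    ∃ hf : CechClosure.IsCont (CechClosure.ofTop UnitAddCircle) (CechClosure.cyc m n)
        (CechClosure.nearest n),
      ∀ x : UnitAddCircle,
        Function.Bijective (CechClosure.PiOne.map (CechClosure.nearest n) hf x) :=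
  have hm : 1 ≤ m := by omega
  ⟨CechClosure.isCont_nearest hm, fun x =>
    ⟨CechClosure.map_nearest_injective hm hmn x, CechClosure.map_nearest_surjective hm hmn x⟩⟩
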